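/- Let $m\ge 1$, $N\ge 0$, $\ell_1,\dots,\ell_m\ge 0$ be integers, put $\mathcal M=\{1,\dots,m\}$, and let $\mathbb F_q$ be a finite field with $q>m$ elements. A file is a vector $\mathbf w\in\mathbb F_q^N$, and user $i\in\mathcal M$ observes $\mathbf x_i=\mathbf A_i\mathbf w$, where $\mathbf A_i\in\mathbb F_q^{\ell_i\times N}$ is a given matrix. For $T\subseteq\mathcal M$ let $\mathbf A_T$ be the matrix obtained by stacking the rows of all $\mathbf A_i$, $i\in T$. The cut-set region is $$\mathcal R=\Big\{\mathbf R\in\mathbb R^m:\ \sum_{i\in S}R_i\ \ge\ N-\operatorname{rank}(\mathbf A_{\mathcal M\setminus S})\ \text{ for all } S\subsetneq\mathcal M\Big\},$$ where $S=\emptyset$ is included (so that $\mathcal R\neq\emptyset$ requires $\operatorname{rank}(\mathbf A_{\mathcal M})=N$). Theorem. Every integer vector $\mathbf R\in\mathbb Z^m$ in $\mathcal R$ (with $R_1\ge 0$ in case $m=1$) has $R_i\ge 0$ for all $i$ and is achievable by linear network coding: there are matrices $\mathbf B_i\in\mathbb F_q^{R_i\times\ell_i}$, $i\in\mathcal M$,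 such that, if each user $i$ broadcasts the $R_i$ linear combinations $\mathbf v_i=\mathbf B_i\mathbf x_i$ of its own observations, then every user can decode the whole file, i.e. for every $i\in\mathcal M$ there is a function $\psi_i:\mathbb F_q^{\ell_i}\times\mathbb F_q^{R_1}\times\cdots\times\mathbb F_q^{R_m}\to\mathbb F_q^N$ with $\psi_i(\mathbf x_i,\mathbf v_1,\dots,\mathbf v_m)=\mathbf w$ for all $\mathbf w\in\mathbb F_q^N$. -/

import Mathlib

open scoped Matrix

namespace DataExchange

/-- The matrix `A_T`: all rows of the observation matrices `A i` of the users `i ∈ T`, stacked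
on top of each other. -/
def stacked {F : Type*} {m N : ℕ} {ℓ : Fin m → ℕ}
    (A : (i : Fin m) → Matrix (Fin (ℓ i)) (Fin N) F) (T : Finset (Fin m)) :
    Matrix (Σ i : {i : Fin m // i ∈ T}, Fin (ℓ i.1)) (Fin N) F :=
  Matrix.of fun p k => A p.1.1 p.2 k

/-- The cut-set region: all real vectors `R` with `R(S) ≥ N - rank A_{M ∖ S}` for every proper
subset `S` of the set of users (the empty set included, which says that all the observations
together have rank `N`). -/
def cutSetRegion {F : Type*} [Field F] {m N : ℕ} {ℓ : Fin m → ℕ}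
    (A : (i : Fin m) → Matrix (Fin (ℓ i)) (Fin N) F) : Set (Fin m → ℝ) :=
  {R | ∀ S : Finset (Fin m), S ⊂ Finset.univ →
    (N : ℝ) - ((stacked A Sᶜ).rank : ℝ) ≤ ∑ i ∈ S, R i}

/-- User `i` broadcasts `r i` symbols `v i`, a function `enc i` of its own observation
`x i = A i *ᵥ w`. The scheme is decodable if every user `i` has a decoding function that
recovers every file `w` from `x i` and all the transmissions. -/
def IsDecodable {F : Type*} [Field F] {m N : ℕ} {ℓ : Fin m → ℕ}
    (A : (i : Fin m) → Matrix (Fin (ℓ i)) (Fin N) F) {r : Fin m → ℕ}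
    (enc : (i : Fin m) → (Fin (ℓ i) → F) → (Fin (r i) → F)) : Prop :=
  ∀ i : Fin m, ∃ ψ : (Fin (ℓ i) → F) → ((j : Fin m) → Fin (r j) → F) → (Fin N → F),
    ∀ w : Fin N → F, ψ (A i *ᵥ w) (fun j => enc j (A j *ᵥ w)) = w

/-- The rate vector `r` is achievable by linear network coding: there are transmission matrices
`B i` of size `r i × ℓ i` such that the scheme in which user `i` broadcasts the `r i` linear
combinations `B i *ᵥ x i` of its own observations is decodable. -/
def IsLinearlyAchievable {F : Type*} [Field F] {m N : ℕ} {ℓ : Fin m → ℕ}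
    (A : (i : Fin m) → Matrix (Fin (ℓ i)) (Fin N) F) (r : Fin m → ℕ) : Prop :=
  ∃ B : (i : Fin m) → Matrix (Fin (r i)) (Fin (ℓ i)) F,
    IsDecodable A (fun i x => B i *ᵥ x)

end DataExchange

/-!
Let `W i` be the row space of `A i`. A scheme in which user `i` broadcasts `R i` linear combinations
amounts to subspaces `C i ≤ W i` with `dim (C i) ≤ R i`, and user `k` can decode as soon as
`W k ⊔ ⨆ i, C i` is the whole space. The vectors spanning the `C i` are picked one at a time.

If `U` is the span of the vectors picked so far and `R` is the vector of remaining rates, the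
invariant is the cut-set condition modulo `U` (`CutSetCondition`):
`dim V ≤ R(S) + dim (U ⊔ ⨆ i ∉ S, W i)` for every proper subset `S` of the users. Once `R = 0`, its
instances `S = {k}ᶜ` say that every user `k` can decode. To lower `R i` by one, a vector `v ∈ W i`
has to avoid `U ⊔ ⨆ j ∉ S, W j` for all tight sets `S ∋ i`, those with equality in the cut-set
condition. By submodularity, tight sets whose union is proper are closed under intersection
(`CutSetCondition.isTight_inter`). So, for each user `k ≠ i`, the tight sets that contain `i` and
miss `k` have a least member, whose subspace contains those of all the others. Hence only at most
`m - 1` subspaces have to be avoided, each of them meets `W i` in a proper subspace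
(`CutSetCondition.not_le_of_isTight`), and fewer than `q` proper subspaces do not cover `W i`
(`CutSetCondition.exists_mem_forall_notMem`).
-/

namespace DataExchange

open Module

/-! ### The cut-set condition for a family of subspaces -/

section Subspaces

variable {ι F V : Type*} [Fintype ι] [DecidableEq ι] [Field F] [AddCommGroup V] [Module F V]

/-- The subspace known to the users outside `S` together, when the vectors in `U` are public. -/
def knownOutside (U : Submodule F V) (W : ι → Submodule F V) (S : Finset ι) : Submodule F V :=
  U ⊔ ⨆ i ∈ Sᶜ, W i

/-- The cut-set inequalities modulo `U`: for each proper subset `S` of the users, the rates of the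
users in `S` make up for the dimensions that the users outside `S` lack. -/
def CutSetCondition (U : Submodule F V) (W : ι → Submodule F V) (R : ι → ℕ) : Prop :=
  ∀ S : Finset ι, S ≠ Finset.univ → finrank F V ≤ ∑ i ∈ S, R i + finrank F (knownOutside U W S)

/-- A proper subset `S` of the users is tight if its cut-set inequality is an equality. -/
def IsTight (U : Submodule F V) (W : ι → Submodule F V) (R : ι → ℕ) (S : Finset ι) : Prop :=
  S ≠ Finset.univ ∧ ∑ i ∈ S, R i + finrank F (knownOutside U W S) = finrank F V

variable {U : Submodule F V} {W : ι → Submodule F V} {R : ι → ℕ} {S T : Finset ι} {i : ι} {v : V}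

theorem le_knownOutside (hi : i ∉ S) : W i ≤ knownOutside U W S :=
  le_sup_of_le_right (le_biSup W (Finset.mem_compl.2 hi))

theorem knownOutside_le {X : Submodule F V} :
    knownOutside U W S ≤ X ↔ U ≤ X ∧ ∀ i ∉ S, W i ≤ X := by
  simp [knownOutside]

theorem knownOutside_anti (h : S ⊆ T) : knownOutside U W T ≤ knownOutside U W S :=
  knownOutside_le.2 ⟨le_sup_left, fun _ hi => le_knownOutside fun hS => hi (h hS)⟩

theorem knownOutside_inter :
    knownOutside U W (S ∩ T) = knownOutside U W S ⊔ knownOutside U W T := by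
  refine le_antisymm (knownOutside_le.2 ⟨le_sup_of_le_left le_sup_left, fun i hi => ?_⟩)
    (sup_le (knownOutside_anti Finset.inter_subset_left)
      (knownOutside_anti Finset.inter_subset_right))
  by_cases hS : i ∈ S
  · exact le_sup_of_le_right
      (le_knownOutside fun hT => hi (Finset.mem_inter.2 ⟨hS, hT⟩))
  · exact le_sup_of_le_left (le_knownOutside hS)

theorem knownOutside_sup_span :
    knownOutside (U ⊔ F ∙ v) W S = knownOutside U W S ⊔ F ∙ v := by
  exact sup_right_comm _ _ _

theorem finrank_sup_span_singleton_of_notMem [FiniteDimensional F V] {X : Submodule F V}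
    (hv : v ∉ X) : finrank F X + 1 ≤ finrank F (X ⊔ F ∙ v : Submodule F V) := by
  refine Submodule.finrank_lt_finrank_of_lt (lt_of_le_of_ne le_sup_left fun h => hv ?_)
  rw [h]
  exact Submodule.mem_sup_right (Submodule.mem_span_singleton_self v)

theorem finrank_sup_span_singleton_le [FiniteDimensional F V] (X : Submodule F V) (v : V) :
    finrank F (X ⊔ F ∙ v : Submodule F V) ≤ finrank F X + 1 := by
  refine (Submodule.finrank_add_le_finrank_add_finrank X (F ∙ v)).trans ?_
  gcongr
  exact (finrank_span_le_card {v}).trans (by simp)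

/-- Tight sets are closed under intersection as long as their union is proper: the right-hand side
of the cut-set inequality is a submodular function of the set. -/
theorem CutSetCondition.isTight_inter [FiniteDimensional F V] (h : CutSetCondition U W R)
    (hS : IsTight U W R S) (hT : IsTight U W R T) (hST : S ∪ T ≠ Finset.univ) :
    IsTight U W R (S ∩ T) := by
  have hI : S ∩ T ≠ Finset.univ := fun hI =>
    hS.1 (Finset.univ_subset_iff.1 (hI ▸ Finset.inter_subset_left))
  refine ⟨hI, (h _ hI).antisymm' ?_⟩
  have h1 := Submodule.finrank_sup_add_finrank_inf_eq (knownOutside U W S) (knownOutside U W T)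
  have h2 : finrank F (knownOutside U W (S ∪ T)) ≤
      finrank F (knownOutside U W S ⊓ knownOutside U W T : Submodule F V) :=
    Submodule.finrank_mono (le_inf (knownOutside_anti Finset.subset_union_left)
      (knownOutside_anti Finset.subset_union_right))
  have h3 := Finset.sum_union_inter (s₁ := S) (s₂ := T) (f := R)
  have h4 := h _ hST
  have h5 := hS.2
  have h6 := hT.2
  rw [knownOutside_inter]
  omega

/-- If a user `i` with a positive remaining rate belongs to a tight set `S`, then it knows something
that the users outside `S` do not know: otherwise `S \ {i}` would violate its inequality. -/
theorem CutSetCondition.not_le_of_isTight [FiniteDimensional F V] (h : CutSetCondition U W R)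
    (hS : IsTight U W R S) (hi : i ∈ S) (hR : 0 < R i) : ¬ W i ≤ knownOutside U W S := by
  intro hle
  have h1 := h (S.erase i) fun hu => by simpa [hu] using Finset.notMem_erase i S
  have h2 : finrank F (knownOutside U W (S.erase i)) ≤ finrank F (knownOutside U W S) := by
    refine Submodule.finrank_mono (knownOutside_le.2 ⟨le_sup_left, fun j hj => ?_⟩)
    by_cases hji : j = i
    · exact hji ▸ hle
    · exact le_knownOutside fun hjS => hj (Finset.mem_erase.2 ⟨hji, hjS⟩)
  have h3 := Finset.add_sum_erase S R hi
  have h4 := hS.2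
  omega

/-- A user with a positive remaining rate has an observation that is new to the complement of each
tight set containing this user. -/
theorem CutSetCondition.exists_mem_forall_notMem [FiniteDimensional F V] [Fintype F]
    (h : CutSetCondition U W R) (hq : Fintype.card ι < Fintype.card F) (hR : 0 < R i) :
    ∃ v ∈ W i, ∀ S, IsTight U W R S → i ∈ S → v ∉ knownOutside U W S := by
  classical
  let 𝒯 (k : ι) : Finset (Finset ι) := {S | IsTight U W R S ∧ i ∈ S ∧ k ∉ S}
  have h𝒯 {k S} : S ∈ 𝒯 k ↔ IsTight U W R S ∧ i ∈ S ∧ k ∉ S := by simp [𝒯]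
  have hmin (k : {k // (𝒯 k).Nonempty}) : ∃ S ∈ 𝒯 k, ∀ T ∈ 𝒯 k, S ⊆ T := by
    obtain ⟨S, hS, hmin⟩ := Finset.exists_min_image (𝒯 k) Finset.card k.2
    refine ⟨S, hS, fun T hT => ?_⟩
    have hS' := h𝒯.1 hS
    have hT' := h𝒯.1 hT
    have hI : S ∩ T ∈ 𝒯 k := h𝒯.2
      ⟨h.isTight_inter hS'.1 hT'.1 fun hu => by
          have := Finset.mem_univ (k : ι)
          rw [← hu] at this
          simp [hS'.2.2, hT'.2.2] at this,
        Finset.mem_inter.2 ⟨hS'.2.1, hT'.2.1⟩, fun hk => hS'.2.2 (Finset.mem_inter.1 hk).1⟩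
    exact Finset.inter_eq_left.1
      (Finset.eq_of_subset_of_card_le Finset.inter_subset_left (hmin _ hI))
  choose Smin hmem hle using hmin
  have hcover := Submodule.iUnion_ssubset_of_forall_ne_top_of_card_lt Finset.univ
    (fun k => (knownOutside U W (Smin k)).comap (W i).subtype)
    (fun k htop => h.not_le_of_isTight (h𝒯.1 (hmem k)).1 (h𝒯.1 (hmem k)).2.1 hR
      (Submodule.comap_subtype_eq_top.1 htop))
    (by
      rw [ENat.card_eq_coe_fintype_card, Nat.cast_lt, Finset.card_univ]
      exact (Fintype.card_subtype_le _).trans_lt hq)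
  obtain ⟨v, -, hv⟩ := Set.exists_of_ssubset hcover
  refine ⟨v, v.2, fun S hS hiS hvS => hv ?_⟩
  -- A tight set is proper, so it misses some user `k` and contains the least member of `𝒯 k`.
  obtain ⟨k, hk⟩ : ∃ k, k ∉ S := by
    by_contra! hall
    exact hS.1 (Finset.eq_univ_iff_forall.2 hall)
  have hSk : S ∈ 𝒯 k := h𝒯.2 ⟨hS, hiS, hk⟩
  simp only [Set.mem_iUnion]
  exact ⟨⟨k, S, hSk⟩, Finset.mem_univ _, knownOutside_anti (hle ⟨k, S, hSk⟩ S hSk) hvS⟩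

/-- Publishing a vector that is new to the complement of each tight set containing `i`, at the cost
of one unit of the rate of `i`, preserves the cut-set condition. -/
theorem CutSetCondition.sup_span [FiniteDimensional F V] (h : CutSetCondition U W R)
    (hR : 0 < R i)
    (hv : ∀ S, IsTight U W R S → i ∈ S → v ∉ knownOutside U W S) :
    CutSetCondition (U ⊔ F ∙ v) W (Function.update R i (R i - 1)) := by
  intro S hS
  have h1 := h S hS
  rw [knownOutside_sup_span]
  have hmono : finrank F (knownOutside U W S) ≤
      finrank F (knownOutside U W S ⊔ F ∙ v : Submodule F V) :=
    Submodule.finrank_mono le_sup_left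
  by_cases hi : i ∈ S
  · have h2 := Finset.add_sum_erase S R hi
    rw [Finset.sum_update_of_mem hi, Finset.sdiff_singleton_eq_erase]
    by_cases ht : IsTight U W R S
    · have h3 := finrank_sup_span_singleton_of_notMem (hv S ht hi)
      omega
    · have h3 : ∑ i ∈ S, R i + finrank F (knownOutside U W S) ≠ finrank F V := fun h3 =>
        ht ⟨hS, h3⟩
      omega
  · rw [Finset.sum_update_of_notMem hi]
    omega

/-- Under the cut-set condition over a large enough field, the users can choose subspaces `C i` of
what they know, of dimensions at most their rates, that complete the knowledge of every user. -/
theorem CutSetCondition.exists_subspaces [FiniteDimensional F V] [Fintype F]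
    (hq : Fintype.card ι < Fintype.card F) (W : ι → Submodule F V) (U : Submodule F V) (R : ι → ℕ)
    (h : CutSetCondition U W R) :
    ∃ C : ι → Submodule F V, (∀ i, C i ≤ W i) ∧ (∀ i, finrank F (C i) ≤ R i) ∧
      ∀ k, U ⊔ W k ⊔ ⨆ i, C i = ⊤ := by
  induction hn : ∑ i, R i generalizing U R with
  | zero =>
    refine ⟨fun _ => ⊥, fun _ => bot_le, fun i => by simp, fun k => ?_⟩
    have hk : (Finset.univ : Finset ι).erase k ≠ Finset.univ := fun hu => by
      simpa [hu] using Finset.notMem_erase k Finset.univ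
    have h0 : ∑ i ∈ Finset.univ.erase k, R i = 0 := Nat.le_zero.1
      (hn ▸ Finset.sum_le_sum_of_subset (Finset.erase_subset _ _))
    have h1 := h _ hk
    rw [h0, zero_add] at h1
    have h2 := Submodule.eq_top_of_finrank_eq (le_antisymm (Submodule.finrank_le _) h1)
    rw [eq_top_iff, ← h2, knownOutside_le]
    refine ⟨le_sup_of_le_left le_sup_left, fun j hj => ?_⟩
    obtain rfl : j = k := by simpa using hj
    exact le_sup_of_le_left le_sup_right
  | succ n ih =>
    obtain ⟨i, -, hi⟩ : ∃ i ∈ Finset.univ, R i ≠ 0 := by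
      by_contra! h0
      simp [Finset.sum_eq_zero h0] at hn
    have hR : 0 < R i := Nat.pos_of_ne_zero hi
    obtain ⟨v, hvW, hv⟩ := h.exists_mem_forall_notMem hq hR
    obtain ⟨C, hCW, hCR, hC⟩ := ih _ _ (h.sup_span hR hv) (by
      have h2 := Finset.add_sum_erase Finset.univ R (Finset.mem_univ i)
      rw [Finset.sum_update_of_mem (Finset.mem_univ i), Finset.sdiff_singleton_eq_erase]
      omega)
    refine ⟨Function.update C i (C i ⊔ F ∙ v), fun j => ?_, fun j => ?_, fun k => ?_⟩
    · obtain rfl | hj := eq_or_ne j i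
      · simpa using ⟨hCW j, hvW⟩
      · simpa [hj] using hCW j
    · obtain rfl | hj := eq_or_ne j i
      · have h1 := hCR j
        have h2 := finrank_sup_span_singleton_le (C j) v
        rw [Function.update_self] at h1 ⊢
        omega
      · have h1 := hCR j
        rw [Function.update_of_ne hj] at h1 ⊢
        exact h1
    · have hle := le_iSup (Function.update C i (C i ⊔ F ∙ v)) i
      rw [Function.update_self, sup_le_iff] at hle
      rw [eq_top_iff, ← hC k]
      refine sup_le (sup_le (sup_le ?_ ?_) ?_) (iSup_le fun j => ?_)
      · exact le_sup_of_le_left le_sup_left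
      · exact le_sup_of_le_right hle.2
      · exact le_sup_of_le_left le_sup_right
      · obtain rfl | hj := eq_or_ne j i
        · exact le_sup_of_le_right hle.1
        · refine le_sup_of_le_right (le_iSup_of_le j ?_)
          rw [Function.update_of_ne hj]

end Subspaces

/-! ### Matrices and their row spaces -/

section Matrices

variable {F : Type*} [Field F] {m N : ℕ} {ℓ : Fin m → ℕ}

/-- The row space of a matrix. -/
def rowSpace {n : ℕ} (M : Matrix (Fin n) (Fin N) F) : Submodule F (Fin N → F) :=
  Submodule.span F (Set.range M.row)

theorem rank_stacked (A : (i : Fin m) → Matrix (Fin (ℓ i)) (Fin N) F) (T : Finset (Fin m)) :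
    (stacked A T).rank = finrank F (⨆ i ∈ T, rowSpace (A i) : Submodule F (Fin N → F)) := by
  rw [Matrix.rank_eq_finrank_span_row]
  have hrows : Set.range (stacked A T).row = ⋃ i ∈ T, Set.range (A i).row := by
    ext w
    constructor
    · rintro ⟨⟨⟨i, hi⟩, j⟩, rfl⟩
      exact Set.mem_biUnion hi ⟨j, rfl⟩
    · intro hw
      obtain ⟨i, hi, j, rfl⟩ := Set.mem_iUnion₂.1 hw
      exact ⟨⟨⟨i, hi⟩, j⟩, rfl⟩
  rw [hrows, Submodule.span_iUnion₂]
  rfl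

/-- A subspace of the row space of `M` of dimension at most `n` is contained in the row space of a
matrix with `n` rows, each a linear combination of rows of `M`. -/
theorem exists_mul_le_rowSpace {l n : ℕ} (M : Matrix (Fin l) (Fin N) F)
    (C : Submodule F (Fin N → F)) (hC : C ≤ rowSpace M) (hn : finrank F C ≤ n) :
    ∃ B : Matrix (Fin n) (Fin l) F, C ≤ rowSpace (B * M) := by
  let b := finBasis F C
  -- Rows `j < dim C` represent a basis of `C`; the others play no role.
  have hrow (j : Fin n) : ∃ c : Fin l → F, ∀ h : (j : ℕ) < finrank F C,
      c ᵥ* M = (b ⟨j, h⟩ : Fin N → F) := by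
    by_cases h : (j : ℕ) < finrank F C
    · obtain ⟨c, hc⟩ := (Submodule.mem_span_range_iff_exists_fun F).1 (hC (b ⟨j, h⟩).2)
      exact ⟨c, fun _ => by rw [← hc, Matrix.vecMul_eq_sum]; rfl⟩
    · exact ⟨0, fun h' => absurd h' h⟩
  choose c hc using hrow
  refine ⟨Matrix.of c, ?_⟩
  have hspan : C = Submodule.span F (Set.range fun j => (b j : Fin N → F)) := by
    have := congrArg (Submodule.map C.subtype) b.span_eq
    rw [Submodule.map_span, ← Set.range_comp, Submodule.map_subtype_top] at this
    exact this.symm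
  rw [hspan, Submodule.span_le]
  rintro _ ⟨j, rfl⟩
  refine Submodule.subset_span ⟨⟨j, j.2.trans_le hn⟩, ?_⟩
  exact hc ⟨j, j.2.trans_le hn⟩ j.2

theorem dotProduct_eq_zero_of_mem_rowSpace {n : ℕ} {M : Matrix (Fin n) (Fin N) F} {d : Fin N → F}
    (hd : M *ᵥ d = 0) {u : Fin N → F} (hu : u ∈ rowSpace M) : d ⬝ᵥ u = 0 := by
  induction hu using Submodule.span_induction with
  | mem x hx =>
    obtain ⟨j, rfl⟩ := hx
    rw [dotProduct_comm]
    exact congrFun hd j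
  | zero => simp
  | add x y _ _ hx hy => rw [dotProduct_add, hx, hy, add_zero]
  | smul a x _ hx => rw [dotProduct_smul, hx, smul_zero]

/-- User `k` can decode if the rows of `A k` together with those of all the `B i * A i` span the
whole space, because then no two files look the same to this user. -/
theorem isDecodable_of_sup_eq_top {r : Fin m → ℕ} (A : (i : Fin m) → Matrix (Fin (ℓ i)) (Fin N) F)
    (B : (i : Fin m) → Matrix (Fin (r i)) (Fin (ℓ i)) F)
    (h : ∀ k, rowSpace (A k) ⊔ ⨆ i, rowSpace (B i * A i) = ⊤) :
    IsDecodable A (fun i x => B i *ᵥ x) := by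
  intro k
  let obs (w : Fin N → F) : (Fin (ℓ k) → F) × ((j : Fin m) → Fin (r j) → F) :=
    (A k *ᵥ w, fun j => B j *ᵥ (A j *ᵥ w))
  have hinj : Function.Injective obs := by
    intro w w' hw
    have h1 : A k *ᵥ (w - w') = 0 := by
      rw [Matrix.mulVec_sub, sub_eq_zero]
      exact congrArg Prod.fst hw
    have h2 (j : Fin m) : (B j * A j) *ᵥ (w - w') = 0 := by
      rw [Matrix.mulVec_sub, sub_eq_zero, ← Matrix.mulVec_mulVec, ← Matrix.mulVec_mulVec]
      exact congrFun (congrArg Prod.snd hw) j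
    have htop : (⊤ : Submodule F (Fin N → F)) ≤
        LinearMap.ker (dotProductBilin F F (w - w')) := by
      rw [← h k]
      exact sup_le (fun u hu => dotProduct_eq_zero_of_mem_rowSpace h1 hu)
        (iSup_le fun j u hu => dotProduct_eq_zero_of_mem_rowSpace (h2 j) hu)
    exact sub_eq_zero.1 (dotProduct_eq_zero _ fun u => htop (Submodule.mem_top (x := u)))
  obtain ⟨ψ, hψ⟩ := hinj.hasLeftInverse
  exact ⟨fun x v => ψ (x, v), hψ⟩

/-- With at least two users, `S = {i}` is a proper subset and its inequality bounds `R i` below. -/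
theorem nonneg_of_mem_cutSetRegion {A : (i : Fin m) → Matrix (Fin (ℓ i)) (Fin N) F}
    {R : Fin m → ℝ} (hR : R ∈ cutSetRegion A) (hm : m ≠ 1) (i : Fin m) : 0 ≤ R i := by
  have h1 := hR {i} (Finset.ssubset_univ_iff.2 fun hu => hm <| by
    simpa using (congrArg Finset.card hu).symm)
  have h2 : ((stacked A {i}ᶜ).rank : ℝ) ≤ N := by
    exact_mod_cast (Matrix.rank_le_card_width _).trans_eq (Fintype.card_fin N)
  rw [Finset.sum_singleton] at h1
  linarith

end Matrices

end DataExchange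

theorem theorem1 {F : Type*} [Field F] [Fintype F] (m N : ℕ) (hq : m < Fintype.card F)
    (ℓ : Fin m → ℕ) (A : (i : Fin m) → Matrix (Fin (ℓ i)) (Fin N) F)
    (R : Fin m → ℤ) (hR : (fun i => (R i : ℝ)) ∈ DataExchange.cutSetRegion A)
    (hR1 : m = 1 → ∀ i, 0 ≤ R i) :
    ∃ r : Fin m → ℕ, (∀ i, (r i : ℤ) = R i) ∧ DataExchange.IsLinearlyAchievable A r := by
  have hnonneg (i : Fin m) : 0 ≤ R i := by
    by_cases hm : m = 1
    · exact hR1 hm i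
    · exact_mod_cast DataExchange.nonneg_of_mem_cutSetRegion hR hm i
  lift R to Fin m → ℕ using hnonneg
  refine ⟨R, fun _ => rfl, ?_⟩
  have hcut : DataExchange.CutSetCondition ⊥ (fun i => DataExchange.rowSpace (A i)) R := by
    intro S hS
    have h := hR S (Finset.ssubset_univ_iff.2 hS)
    rw [DataExchange.rank_stacked] at h
    rw [DataExchange.knownOutside, bot_sup_eq, Module.finrank_fin_fun]
    simp only [Int.cast_natCast] at h
    rw [sub_le_iff_le_add] at h
    exact_mod_cast h
  obtain ⟨C, hCW, hCR, hC⟩ := DataExchange.CutSetCondition.exists_subspaces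
    (by rwa [Fintype.card_fin]) _ _ _ hcut
  choose B hB using fun i => DataExchange.exists_mul_le_rowSpace (A i) (C i) (hCW i) (hCR i)
  refine ⟨B, DataExchange.isDecodable_of_sup_eq_top A B fun k => top_unique ?_⟩
  rw [← hC k, bot_sup_eq]
  exact sup_le_sup_left (iSup_mono hB) _
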